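/- Let $n$ be a natural number and let $\rho$ be an $n$-qubit mixed state, i.e. a positive semidefinite operator of trace one on $(\mathbb{C}^2)^{\otimes n}$, that is symmetric: $P_\pi\rho P_\pi^{-1}=\rho$ for every permutation $\pi$ of the qubits, where $P_\pi$ is the operator that permutes the tensor factors by $\pi$. Let $LG=\bigoplus_{k=1}^n su(2)$, where $su(2)$ is the real Lie algebra of traceless skew-Hermitian $2\times 2$ matrices; for $M\in su(2)$ let $M^{(k)}\in LG$ be the element with $M$ in position $k$ and zero in all other positions, and let $A=i\sigma_z=\operatorname{diag}(i,-i)$. For an $n$-qubit state $\rho$ let $$K_\rho=\Bigl\{(M_1,\dots,M_n)\in LG : \Bigl[\sum_{k=1}^n \mathrm{Id}\otimes\cdots\otimes M_k\otimes\cdots\otimes \mathrm{Id},\ \rho\Bigr]=0\Bigr\}$$ be its local unitary stabilizer subalgebra. Then there are $g_1,\dots,g_n\in SU(2)$ such that the state $\rho'=(g_1\otimes\cdots\otimes g_n)\,\rho\,(g_1\otimes\cdots\otimes g_n)^\dagger$ is again symmetric and $K_{\rho'}$ is equal to one of the following subalgebras of $LG$: (a) all of $LG$; (b) $K_{\mathrm{Werner}}=\{(M,M,\dots,M)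 : M\in su(2)\}$; (c) $K_{\mathrm{product}}=\{\sum_{k=1}^n a_kA^{(k)} : a_k\in\mathbb{R}\}$; (d) $K_{\mathrm{GHZ}}=\{\sum_{k=1}^n a_kA^{(k)} : a_k\in\mathbb{R},\ \sum_{k=1}^n a_k=0\}$; (e) $K_{\mathrm{Dicke}}=\{t\sum_{k=1}^n A^{(k)} : t\in\mathbb{R}\}$; (f) the zero algebra. -/

import Mathlib

open scoped ComplexOrder Matrix

namespace SymStab

attribute [local instance] LieRing.ofAssociativeRing

/-- The one-qubit Lie algebra `su(2)`: the real Lie algebra of traceless skew-Hermitian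
complex `2 × 2` matrices, with the matrix commutator as bracket. -/
def su2 : LieSubalgebra ℝ (Matrix (Fin 2) (Fin 2) ℂ) where
  carrier := {X | Xᴴ = -X ∧ X.trace = 0}
  add_mem' := by
    rintro X Y ⟨hX, hX'⟩ ⟨hY, hY'⟩
    refine ⟨?_, ?_⟩
    · rw [Matrix.conjTranspose_add, hX, hY]; abel
    · rw [Matrix.trace_add, hX', hY', add_zero]
  zero_mem' := by simp
  smul_mem' := by
    rintro c X ⟨hX, hX'⟩
    refine ⟨?_, ?_⟩
    · rw [Matrix.conjTranspose_smul, hX]; simp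
    · rw [Matrix.trace_smul, hX', smul_zero]
  lie_mem' := by
    rintro X Y ⟨hX, -⟩ ⟨hY, -⟩
    refine ⟨?_, ?_⟩
    · rw [Ring.lie_def, Matrix.conjTranspose_sub, Matrix.conjTranspose_mul,
        Matrix.conjTranspose_mul, hX, hY]
      simp
    · rw [Ring.lie_def, Matrix.trace_sub, Matrix.trace_mul_comm, sub_self]

/-- The `n`-qubit local unitary Lie algebra `LG`, the direct sum of `n` copies of `su(2)`,
with componentwise operations. -/
abbrev LG (n : ℕ) : Type := Fin n → su2

noncomputable instance instLieRingLG (n : ℕ) : LieRing (LG n) where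
  bracket M N := fun k => ⁅M k, N k⁆
  add_lie _ _ _ := funext fun _ => add_lie _ _ _
  lie_add _ _ _ := funext fun _ => lie_add _ _ _
  lie_self _ := funext fun _ => lie_self _
  leibniz_lie _ _ _ := funext fun _ => leibniz_lie _ _ _

noncomputable instance instLieAlgebraLG (n : ℕ) : LieAlgebra ℝ (LG n) where
  lie_smul c M N := funext fun k => lie_smul c (M k) (N k)

/-- Linear operators on the `n`-qubit Hilbert space, as matrices in the computational basis,
which is indexed by the bit strings `Fin n → Fin 2`. -/
abbrev Op (n : ℕ) : Type := Matrix (Fin n → Fin 2) (Fin n → Fin 2) ℂ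

/-- The tensor (Kronecker) product `X₁ ⊗ X₂ ⊗ ⋯ ⊗ Xₙ` of one-qubit operators. -/
def tensorOp {n : ℕ} (X : Fin n → Matrix (Fin 2) (Fin 2) ℂ) : Op n :=
  Matrix.of fun I J => ∏ k, X k (I k) (J k)

/-- The operator `1 ⊗ ⋯ ⊗ X ⊗ ⋯ ⊗ 1` with `X` acting on qubit `k`. -/
def siteOp {n : ℕ} (k : Fin n) (X : Matrix (Fin 2) (Fin 2) ℂ) : Op n :=
  tensorOp (Function.update (fun _ => 1) k X)

/-- The operator `∑ₖ 1 ⊗ ⋯ ⊗ Mₖ ⊗ ⋯ ⊗ 1` by which `M = (M₁, …, Mₙ)` in `LG` acts on the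
`n`-qubit Hilbert space. -/
def localOp {n : ℕ} (M : LG n) : Op n :=
  ∑ k, siteOp k (M k : Matrix (Fin 2) (Fin 2) ℂ)

theorem siteOp_apply {n : ℕ} (k : Fin n) (X : Matrix (Fin 2) (Fin 2) ℂ)
    (I J : Fin n → Fin 2) :
    siteOp k X I J =
      X (I k) (J k) * ∏ l ∈ Finset.univ.erase k, (1 : Matrix (Fin 2) (Fin 2) ℂ) (I l) (J l) := by
  rw [siteOp, tensorOp, Matrix.of_apply, ← Finset.mul_prod_erase _ _ (Finset.mem_univ k),
    Function.update_self]
  congr 1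
  refine Finset.prod_congr rfl fun l hl => ?_
  rw [Function.update_of_ne (Finset.ne_of_mem_erase hl)]

theorem tensorOp_mul {n : ℕ} (X Y : Fin n → Matrix (Fin 2) (Fin 2) ℂ) :
    tensorOp X * tensorOp Y = tensorOp (fun k => X k * Y k) := by
  ext I J
  simp only [tensorOp, Matrix.mul_apply, Matrix.of_apply]
  rw [Finset.prod_univ_sum]
  simp [Finset.prod_mul_distrib]

theorem siteOp_mul_same {n : ℕ} (k : Fin n) (X Y : Matrix (Fin 2) (Fin 2) ℂ) :
    siteOp k X * siteOp k Y = siteOp k (X * Y) := by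
  rw [siteOp, siteOp, siteOp, tensorOp_mul]
  congr 1
  funext l
  by_cases h : l = k
  · subst h; simp
  · simp [Function.update_of_ne h]

theorem siteOp_comm {n : ℕ} {k l : Fin n} (h : k ≠ l) (X Y : Matrix (Fin 2) (Fin 2) ℂ) :
    siteOp k X * siteOp l Y = siteOp l Y * siteOp k X := by
  rw [siteOp, siteOp, tensorOp_mul, tensorOp_mul]
  congr 1
  funext m
  by_cases hk : m = k
  · subst hk; simp [Function.update_of_ne h]
  · simp [Function.update_of_ne hk]

theorem localOp_add {n : ℕ} (M N : LG n) : localOp (M + N) = localOp M + localOp N := by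
  ext I J
  simp [localOp, Matrix.sum_apply, siteOp_apply, add_mul, Finset.sum_add_distrib]

theorem localOp_zero {n : ℕ} : localOp (0 : LG n) = 0 := by
  ext I J
  simp [localOp, Matrix.sum_apply, siteOp_apply]

theorem localOp_smul {n : ℕ} (c : ℝ) (M : LG n) : localOp (c • M) = c • localOp M := by
  ext I J
  simp [localOp, Matrix.sum_apply, siteOp_apply, Finset.mul_sum, mul_assoc]

theorem localOp_lie {n : ℕ} (M N : LG n) : localOp ⁅M, N⁆ = ⁅localOp M, localOp N⁆ := by
  have hsub : ∀ (k : Fin n) (X Y : Matrix (Fin 2) (Fin 2) ℂ),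
      siteOp k (X - Y) = siteOp k X - siteOp k Y := by
    intro k X Y
    ext I J
    simp [siteOp_apply, sub_mul]
  simp only [localOp, Ring.lie_def, Finset.sum_mul_sum]
  rw [Finset.sum_comm (f := fun i j => siteOp i (N i : Matrix (Fin 2) (Fin 2) ℂ) * siteOp j
    (M j : Matrix (Fin 2) (Fin 2) ℂ)), ← Finset.sum_sub_distrib]
  refine Finset.sum_congr rfl fun k _ => ?_
  rw [← Finset.sum_sub_distrib, Finset.sum_eq_single k]
  · rw [siteOp_mul_same, siteOp_mul_same, ← hsub]
    rfl
  · intro l _ hl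
    rw [siteOp_comm (Ne.symm hl), sub_self]
  · simp

/-- The local unitary stabilizer subalgebra `K_ρ = {M ∈ LG : [M, ρ] = 0}`. -/
def stabilizer {n : ℕ} (ρ : Op n) : LieSubalgebra ℝ (LG n) where
  carrier := {M | ⁅localOp M, ρ⁆ = 0}
  add_mem' := by
    intro M N hM hN
    change ⁅localOp M, ρ⁆ = 0 at hM
    change ⁅localOp N, ρ⁆ = 0 at hN
    change ⁅localOp (M + N), ρ⁆ = 0
    rw [localOp_add, add_lie, hM, hN, add_zero]
  zero_mem' := by
    change ⁅localOp (0 : LG n), ρ⁆ = 0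
    rw [localOp_zero, zero_lie]
  smul_mem' := by
    intro c M hM
    change ⁅localOp M, ρ⁆ = 0 at hM
    change ⁅localOp (c • M), ρ⁆ = 0
    rw [localOp_smul, smul_lie, hM, smul_zero]
  lie_mem' := by
    intro M N hM hN
    change ⁅localOp M, ρ⁆ = 0 at hM
    change ⁅localOp N, ρ⁆ = 0 at hN
    change ⁅localOp ⁅M, N⁆, ρ⁆ = 0
    rw [localOp_lie, lie_lie, hM, hN, lie_zero, lie_zero, sub_zero]

/-- `A = i σ_z`, as an element of `su(2)`. -/
def A : su2 :=
  ⟨!![Complex.I, 0; 0, -Complex.I], by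
    refine ⟨?_, ?_⟩
    · ext i j
      fin_cases i <;> fin_cases j <;> simp
    · simp [Matrix.trace_fin_two]⟩

/-- `X^{(k)}`: the element of `LG` with `X` in position `k` and zero elsewhere. -/
def atQubit {n : ℕ} (k : Fin n) (X : su2) : LG n := Pi.single k X

theorem sum_smul_atQubit {n : ℕ} (a : Fin n → ℝ) (X : su2) :
    ∑ k, a k • atQubit k X = fun k => a k • X := by
  funext k
  simp [atQubit, Finset.sum_apply, Pi.single_apply]

theorem lie_sum_smul_atQubit {n : ℕ} (a b : Fin n → ℝ) (X : su2) :
    ⁅∑ k, a k • atQubit k X, ∑ k, b k • atQubit k X⁆ = 0 := by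
  rw [sum_smul_atQubit, sum_smul_atQubit]
  funext k
  change ⁅a k • X, b k • X⁆ = 0
  simp

/-- The diagonal `su(2)`: all `(M, M, …, M)` with `M` in `su(2)`. -/
def KWerner (n : ℕ) : LieSubalgebra ℝ (LG n) where
  carrier := {M | ∃ X : su2, M = ∑ k, atQubit k X}
  add_mem' := by
    rintro _ _ ⟨X, rfl⟩ ⟨Y, rfl⟩
    exact ⟨X + Y, by simp [atQubit, Pi.single_add, Finset.sum_add_distrib]⟩
  zero_mem' := ⟨0, by simp [atQubit]⟩
  smul_mem' := by
    rintro c _ ⟨X, rfl⟩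
    exact ⟨c • X, by simp [atQubit, Pi.single_smul, Finset.smul_sum]⟩
  lie_mem' := by
    rintro _ _ ⟨X, rfl⟩ ⟨Y, rfl⟩
    have h : ∀ Z : su2, ∑ k : Fin n, atQubit k Z = fun _ => Z := fun Z => by
      simpa using sum_smul_atQubit (n := n) (fun _ => 1) Z
    refine ⟨⁅X, Y⁆, ?_⟩
    rw [h, h, h]
    rfl

/-- All real linear combinations of `A^{(1)}, …, A^{(n)}`. -/
def KProduct (n : ℕ) : LieSubalgebra ℝ (LG n) where
  carrier := {M | ∃ a : Fin n → ℝ, M = ∑ k, a k • atQubit k A}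
  add_mem' := by
    rintro _ _ ⟨a, rfl⟩ ⟨b, rfl⟩
    exact ⟨a + b, by simp [add_smul, Finset.sum_add_distrib]⟩
  zero_mem' := ⟨0, by simp⟩
  smul_mem' := by
    rintro c _ ⟨a, rfl⟩
    exact ⟨c • a, by simp [mul_smul, Finset.smul_sum]⟩
  lie_mem' := by
    rintro _ _ ⟨a, rfl⟩ ⟨b, rfl⟩
    exact ⟨0, by rw [lie_sum_smul_atQubit]; simp⟩

/-- All real linear combinations of `A^{(1)}, …, A^{(n)}` whose coefficients sum to zero. -/
def KGHZ (n : ℕ) : LieSubalgebra ℝ (LG n) where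
  carrier := {M | ∃ a : Fin n → ℝ, ∑ k, a k = 0 ∧ M = ∑ k, a k • atQubit k A}
  add_mem' := by
    rintro _ _ ⟨a, ha, rfl⟩ ⟨b, hb, rfl⟩
    exact ⟨a + b, by simp [Finset.sum_add_distrib, ha, hb],
      by simp [add_smul, Finset.sum_add_distrib]⟩
  zero_mem' := ⟨0, by simp, by simp⟩
  smul_mem' := by
    rintro c _ ⟨a, ha, rfl⟩
    exact ⟨c • a, by simp [← Finset.mul_sum, ha], by simp [mul_smul, Finset.smul_sum]⟩
  lie_mem' := by
    rintro _ _ ⟨a, -, rfl⟩ ⟨b, -, rfl⟩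
    exact ⟨0, by simp, by rw [lie_sum_smul_atQubit]; simp⟩

/-- The real span of `A^{(1)} + ⋯ + A^{(n)}`. -/
def KDicke (n : ℕ) : LieSubalgebra ℝ (LG n) where
  carrier := {M | ∃ t : ℝ, M = t • ∑ k, atQubit k A}
  add_mem' := by
    rintro _ _ ⟨s, rfl⟩ ⟨t, rfl⟩
    exact ⟨s + t, (add_smul _ _ _).symm⟩
  zero_mem' := ⟨0, by simp⟩
  smul_mem' := by
    rintro c _ ⟨t, rfl⟩
    exact ⟨c * t, by simp [mul_smul]⟩
  lie_mem' := by
    rintro _ _ ⟨s, rfl⟩ ⟨t, rfl⟩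
    exact ⟨0, by simp⟩

/-- A (mixed) `n`-qubit state: a density matrix, i.e. positive semidefinite with trace one. -/
def IsState {n : ℕ} (ρ : Op n) : Prop := ρ.PosSemidef ∧ ρ.trace = 1

/-- The operator `P_π` that permutes the qubits:
it sends the basis vector `|J⟩` to `|J ∘ π⁻¹⟩`. -/
def permOp {n : ℕ} (π : Equiv.Perm (Fin n)) : Op n :=
  Matrix.of fun I J => if I = J ∘ ⇑π⁻¹ then 1 else 0

/-- `permOp` is invertible, with inverse the operator of the inverse permutation. -/
theorem permOp_inv {n : ℕ} (π : Equiv.Perm (Fin n)) : (permOp π)⁻¹ = permOp π⁻¹ := by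
  refine Matrix.inv_eq_right_inv ?_
  ext I J
  simp [permOp, Matrix.mul_apply, Matrix.one_apply, Function.comp_assoc]

/-- Invariance under all qubit permutations: `P_π ρ P_π⁻¹ = ρ`. -/
def IsSymmetric {n : ℕ} (ρ : Op n) : Prop :=
  ∀ π : Equiv.Perm (Fin n), permOp π * ρ * (permOp π)⁻¹ = ρ

/-- Local unitary equivalence: `ρ' = (g₁ ⊗ ⋯ ⊗ gₙ) ρ (g₁ ⊗ ⋯ ⊗ gₙ)†` for some
`g₁, …, gₙ` in `SU(2)`. -/
def LUEquivalent {n : ℕ} (ρ ρ' : Op n) : Prop :=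
  ∃ g : Fin n → Matrix.specialUnitaryGroup (Fin 2) ℂ,
    ρ' = tensorOp (fun k => (g k : Matrix (Fin 2) (Fin 2) ℂ)) * ρ *
      (tensorOp (fun k => (g k : Matrix (Fin 2) (Fin 2) ℂ)))ᴴ

end SymStab

/-! Symmetry of ρ makes K = `stabilizer ρ` invariant under permuting the n components. Since su(2)
is ℝ³ with twice the cross product, it has no two-dimensional subalgebra. So either all components
of all elements of K lie on one line, or K projects onto every factor.

On a line: a common rotation carries the line to ℝA, and K becomes a permutation-invariant subspace
of ℝⁿ. There are four of these (`invariant_submodule`), giving product, GHZ, Dicke and zero.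

Onto: su(2) is simple, so a Goursat argument (`eq_top_or_components_injective`) gives K = LG unless
each component determines all others. In that case the transposition of i and j, which fixes any
third index, forces M i = M j: the Werner algebra. For n = 2 there is no third index, and K may be
the graph of a rotation by π about some x (`exists_rot_mem`). Conjugation by 1 ⊗ x straightens the
graph to the diagonal, and the state stays symmetric because x ⊗ x commutes with ρ. -/

open scoped ComplexOrder Matrix

namespace SymStab

attribute [local instance] LieRing.ofAssociativeRing

/-! ### The Lie algebra su(2) as Euclidean ℝ³. -/

section Coordinates

/-- The three real coordinates of an element of `su(2)`. -/
def coord (X : su2) : Fin 3 → ℝ :=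
  ![(X.1 0 0).im, (X.1 0 1).re, (X.1 0 1).im]

/-- The matrix of an element of `su(2)` in terms of its coordinates. -/
theorem coe_eq_coord (X : su2) :
    (X : Matrix (Fin 2) (Fin 2) ℂ) =
      !![⟨0, coord X 0⟩, ⟨coord X 1, coord X 2⟩; ⟨-coord X 1, coord X 2⟩, ⟨0, -coord X 0⟩] := by
  obtain ⟨X, hX, htr⟩ := X
  have h00 := congrFun (congrFun hX 0) 0
  have h10 := congrFun (congrFun hX 1) 0
  rw [Matrix.trace_fin_two] at htr
  simp only [Matrix.conjTranspose_apply, Matrix.neg_apply, Complex.ext_iff, Complex.star_def,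
    Complex.conj_re, Complex.conj_im, Complex.neg_re, Complex.neg_im, Complex.add_re,
    Complex.add_im, Complex.zero_re, Complex.zero_im] at h00 h10 htr
  ext i j
  fin_cases i <;> fin_cases j <;> apply Complex.ext <;> simp [coord] <;> linarith

theorem coord_injective : Function.Injective coord := by
  intro X Y h
  apply Subtype.ext
  rw [coe_eq_coord, coe_eq_coord, h]

theorem ext_coord {X Y : su2} (h0 : coord X 0 = coord Y 0) (h1 : coord X 1 = coord Y 1)
    (h2 : coord X 2 = coord Y 2) : X = Y := by
  apply coord_injective
  ext i
  fin_cases i <;> assumption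

@[simp] theorem coord_add (X Y : su2) (i : Fin 3) : coord (X + Y) i = coord X i + coord Y i := by
  fin_cases i <;> simp [coord]

@[simp] theorem coord_sub (X Y : su2) (i : Fin 3) : coord (X - Y) i = coord X i - coord Y i := by
  fin_cases i <;> simp [coord]

@[simp] theorem coord_smul (c : ℝ) (X : su2) (i : Fin 3) : coord (c • X) i = c * coord X i := by
  fin_cases i <;> simp [coord]

@[simp] theorem coord_zero (i : Fin 3) : coord 0 i = 0 := by
  fin_cases i <;> simp [coord]

theorem coe_lie_su2 (X Y : su2) :
    ((⁅X, Y⁆ : su2) : Matrix (Fin 2) (Fin 2) ℂ) = X.1 * Y.1 - Y.1 * X.1 := rfl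

@[simp] theorem coord_lie_zero (X Y : su2) :
    coord ⁅X, Y⁆ 0 = 2 * (coord X 1 * coord Y 2 - coord X 2 * coord Y 1) := by
  change ((⁅X, Y⁆ : su2).1 0 0).im = _
  rw [coe_lie_su2, coe_eq_coord X, coe_eq_coord Y]
  simp
  ring

@[simp] theorem coord_lie_one (X Y : su2) :
    coord ⁅X, Y⁆ 1 = 2 * (coord X 2 * coord Y 0 - coord X 0 * coord Y 2) := by
  change ((⁅X, Y⁆ : su2).1 0 1).re = _
  rw [coe_lie_su2, coe_eq_coord X, coe_eq_coord Y]
  simp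
  ring

@[simp] theorem coord_lie_two (X Y : su2) :
    coord ⁅X, Y⁆ 2 = 2 * (coord X 0 * coord Y 1 - coord X 1 * coord Y 0) := by
  change ((⁅X, Y⁆ : su2).1 0 1).im = _
  rw [coe_lie_su2, coe_eq_coord X, coe_eq_coord Y]
  simp
  ring

/-- The invariant inner product on `su(2)`. -/
noncomputable def dot (X Y : su2) : ℝ :=
  coord X 0 * coord Y 0 + coord X 1 * coord Y 1 + coord X 2 * coord Y 2

theorem dot_self_pos {X : su2} (hX : X ≠ 0) : 0 < dot X X := by
  by_contra h
  refine hX ?_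
  simp only [dot] at h
  apply ext_coord <;> simp only [coord_zero] <;>
    nlinarith [sq_nonneg (coord X 0), sq_nonneg (coord X 1), sq_nonneg (coord X 2)]

theorem mul_self_su2 (X : su2) :
    X.1 * X.1 = -((dot X X : ℝ) : ℂ) • (1 : Matrix (Fin 2) (Fin 2) ℂ) := by
  rw [coe_eq_coord X]
  ext i j
  fin_cases i <;> fin_cases j <;> apply Complex.ext <;>
    simp [Matrix.mul_apply, Fin.sum_univ_two, dot] <;> ring

/-- The double commutator formula. -/
theorem dot_self_smul (u v : su2) :
    dot u u • v = dot u v • u - (1 / 4 : ℝ) • ⁅u, ⁅u, v⁆⁆ := by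
  -- This is u × (u × v) = (u·v)u - (u·u)v; the bracket is twice the cross product, whence 1/4.
  apply ext_coord <;> simp [dot] <;> ring

theorem eq_smul_of_lie_eq_zero {u v : su2} (hu : u ≠ 0) (h : ⁅u, v⁆ = 0) : ∃ c : ℝ, v = c • u := by
  have h1 := dot_self_smul u v
  rw [h, lie_zero, smul_zero, sub_zero] at h1
  refine ⟨(dot u u)⁻¹ * dot u v, ?_⟩
  rw [mul_smul, ← h1, smul_smul, inv_mul_cancel₀ (dot_self_pos hu).ne', one_smul]

theorem mem_of_mem_of_lie_mem {u v : su2} (huv : ⁅u, v⁆ ≠ 0) (S : Submodule ℝ su2) (hu : u ∈ S)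
    (hv : v ∈ S) (hl : ⁅u, v⁆ ∈ S) (w : su2) : w ∈ S := by
  -- Noncommuting u, v form a basis together with ⁅u, v⁆; the coefficients come from the reciprocal
  -- basis.
  have key : dot ⁅u, v⁆ ⁅u, v⁆ • w = dot w ⁅u, v⁆ • ⁅u, v⁆ + dot w ⁅v, ⁅u, v⁆⁆ • u
      + dot w ⁅⁅u, v⁆, u⁆ • v := by
    apply ext_coord <;> simp [dot] <;> ring
  have h : dot ⁅u, v⁆ ⁅u, v⁆ • w ∈ S := by
    rw [key]
    exact S.add_mem (S.add_mem (S.smul_mem _ hl) (S.smul_mem _ hu)) (S.smul_mem _ hv)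
  exact (S.smul_mem_iff (dot_self_pos huv).ne').1 h

/-- `su(2)` is simple. -/
theorem eq_top_of_lie_mem (S : Submodule ℝ su2) (hS : ∀ u ∈ S, ∀ v, ⁅u, v⁆ ∈ S) {u : su2}
    (hu : u ∈ S) (hu0 : u ≠ 0) : S = ⊤ := by
  rw [eq_top_iff]
  intro v _
  have h : dot u u • v ∈ S := by
    rw [dot_self_smul]
    refine S.sub_mem (S.smul_mem _ hu) (S.smul_mem _ ?_)
    rw [← lie_skew]
    exact S.neg_mem (hS _ (hS _ hu _) _)
  exact (S.smul_mem_iff (dot_self_pos hu0).ne').1 h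

theorem coord_A_zero : coord A 0 = 1 := by simp [coord, A]

theorem coord_A_one : coord A 1 = 0 := by simp [coord, A]

theorem coord_A_two : coord A 2 = 0 := by simp [coord, A]

theorem exists_lie_ne_zero {u : su2} (hu : u ≠ 0) : ∃ v : su2, ⁅u, v⁆ ≠ 0 := by
  by_contra! h
  have hB : !![0, 1; -1, 0] ∈ su2 := by
    refine ⟨?_, by simp [Matrix.trace_fin_two]⟩
    ext i j
    fin_cases i <;> fin_cases j <;> simp
  obtain ⟨B, hB0, hB1, hB2⟩ : ∃ B : su2, coord B 0 = 0 ∧ coord B 1 = 1 ∧ coord B 2 = 0 :=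
    ⟨⟨_, hB⟩, by simp [coord]⟩
  have h1 := congrArg (fun X => coord X 1) (h A)
  have h2 := congrArg (fun X => coord X 2) (h A)
  have h0 := congrArg (fun X => coord X 2) (h B)
  simp only [coord_lie_one, coord_lie_two, coord_zero, coord_A_zero, coord_A_one, coord_A_two, hB0,
    hB1] at h0 h1 h2
  refine hu (ext_coord ?_ ?_ ?_) <;> rw [coord_zero] <;> linarith

theorem A_ne_zero : A ≠ 0 := by
  intro h
  have := congrArg (fun X => coord X 0) h
  simp [coord, A] at this

/-- The rotation by `π` about the axis spanned by a unit vector `x`. -/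
noncomputable def rot (x X : su2) : su2 := (2 * dot x X) • x - X

/-- The anticommutator of X and x is the scalar -2⟨x, X⟩, and x² = -1. Hence conjugation by x,
itself an element of SU(2), acts on su(2) as `rot x`. -/
theorem mul_eq_mul_rot {x : su2} (hx : dot x x = 1) (X : su2) : X.1 * x.1 = x.1 * (rot x X).1 := by
  have h : X.1 * x.1 + x.1 * X.1 =
      -((2 * dot x X : ℝ) : ℂ) • (1 : Matrix (Fin 2) (Fin 2) ℂ) := by
    rw [coe_eq_coord X, coe_eq_coord x]
    ext i j
    fin_cases i <;> fin_cases j <;> apply Complex.ext <;>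
      simp [dot] <;> ring
  have hr : (rot x X).1 = ((2 * dot x X : ℝ) : ℂ) • x.1 - X.1 := by
    ext i j
    simp [rot]
  rw [hr, mul_sub, mul_smul_comm, mul_self_su2, hx, eq_sub_iff_add_eq, h]
  simp

theorem rot_rot {x : su2} (hx : dot x x = 1) (X : su2) : rot x (rot x X) = X := by
  have h : dot x (rot x X) = dot x X := by
    have : dot x (rot x X) = 2 * dot x X * dot x x - dot x X := by
      simp [dot, rot]; ring
    rw [this, hx]; ring
  rw [rot, h, rot, sub_sub_cancel]

theorem rot_smul (x : su2) (c : ℝ) (X : su2) : rot x (c • X) = c • rot x X := by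
  apply ext_coord <;> simp [rot, dot] <;> ring

theorem rot_add (x X Y : su2) : rot x (X + Y) = rot x X + rot x Y := by
  apply ext_coord <;> simp [rot, dot] <;> ring

theorem dot_smul_smul (c : ℝ) (X : su2) : dot (c • X) (c • X) = c ^ 2 * dot X X := by
  simp [dot]; ring

theorem exists_smul_unit {u : su2} (hu : u ≠ 0) : ∃ c : ℝ, c ≠ 0 ∧ dot (c • u) (c • u) = 1 := by
  have h := dot_self_pos hu
  refine ⟨(√(dot u u))⁻¹, by positivity, ?_⟩
  rw [dot_smul_smul, inv_pow, Real.sq_sqrt h.le, inv_mul_cancel₀ h.ne']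

theorem dot_A : dot A A = 1 := by simp [dot, coord, A]

/-- Any nonzero vector can be rotated into the line of `A` by a rotation by `π`. -/
theorem exists_rot_eq {u : su2} (hu : u ≠ 0) :
    ∃ x : su2, dot x x = 1 ∧ ∃ c : ℝ, rot x u = c • A := by
  obtain ⟨c, hc, hcu⟩ := exists_smul_unit hu
  -- The axis is the bisector of A and the unit vector c • u. If they are opposite, u already lies
  -- on the line of A and the axis A serves.
  by_cases hA : A + c • u = 0
  · refine ⟨A, dot_A, -c⁻¹, ?_⟩
    have h : u = -c⁻¹ • A := by
      rw [eq_neg_of_add_eq_zero_left hA, neg_smul, smul_neg, neg_neg, smul_smul,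
        inv_mul_cancel₀ hc, one_smul]
    rw [h, rot_smul]
    congr 1
    have h' : rot A A = (2 * dot A A) • A - A := rfl
    rw [h', dot_A, mul_one, two_smul, add_sub_cancel_right]
  · obtain ⟨s, hs, hsx⟩ := exists_smul_unit hA
    refine ⟨s • (A + c • u), hsx, c⁻¹, ?_⟩
    have h1 : dot (A + c • u) (A + c • u) = 2 * dot (A + c • u) (c • u) := by
      have : dot (A + c • u) (A + c • u) =
          2 * dot (A + c • u) (c • u) + dot A A - dot (c • u) (c • u) := by
        simp [dot]; ring
      rw [this, dot_A, hcu]; ring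
    have h2 : rot (s • (A + c • u)) (c • u) =
        (s ^ 2 * (2 * dot (A + c • u) (c • u))) • (A + c • u) - c • u := by
      apply ext_coord <;> simp [rot, dot] <;> ring
    rw [← h1, ← dot_smul_smul, hsx, one_smul, add_sub_cancel_right, rot_smul] at h2
    rwa [eq_inv_smul_iff₀ hc]

/-- Unit vectors of `su(2)` belong to `SU(2)`. -/
def toSU (x : su2) (hx : dot x x = 1) : Matrix.specialUnitaryGroup (Fin 2) ℂ :=
  ⟨x.1, Matrix.mem_specialUnitaryGroup_iff.2 ⟨Matrix.mem_unitaryGroup_iff.2 (by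
    rw [Matrix.star_eq_conjTranspose, x.2.1, mul_neg, mul_self_su2, hx]; simp), by
    rw [coe_eq_coord, Matrix.det_fin_two]
    simp only [dot] at hx
    apply Complex.ext <;> simp <;> linarith⟩⟩

end Coordinates

/-! ### Local unitaries and stabilizers. -/

section Conjugation

variable {n : ℕ}

theorem siteOp_mul_tensorOp (k : Fin n) (g : Fin n → Matrix (Fin 2) (Fin 2) ℂ)
    {X Y : Matrix (Fin 2) (Fin 2) ℂ} (h : X * g k = g k * Y) :
    siteOp k X * tensorOp g = tensorOp g * siteOp k Y := by
  rw [siteOp, siteOp, tensorOp_mul, tensorOp_mul]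
  congr 1
  funext l
  by_cases hl : l = k
  · subst hl; simp [h]
  · simp [Function.update_of_ne hl]

theorem localOp_mul_tensorOp (g : Fin n → Matrix (Fin 2) (Fin 2) ℂ) {M N : LG n}
    (h : ∀ k, (M k).1 * g k = g k * (N k).1) :
    localOp M * tensorOp g = tensorOp g * localOp N := by
  simp only [localOp, Finset.sum_mul, Finset.mul_sum]
  exact Finset.sum_congr rfl fun k _ => siteOp_mul_tensorOp k g (h k)

theorem conjTranspose_tensorOp (g : Fin n → Matrix (Fin 2) (Fin 2) ℂ) :
    (tensorOp g)ᴴ = tensorOp fun k => (g k)ᴴ := by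
  ext I J
  simp [tensorOp]

theorem tensorOp_one : tensorOp (fun _ : Fin n => 1) = 1 := by
  ext I J
  by_cases h : I = J
  · subst h; simp [tensorOp]
  · obtain ⟨k, hk⟩ := Function.ne_iff.1 h
    rw [Matrix.one_apply_ne h]
    exact Finset.prod_eq_zero (Finset.mem_univ k) (Matrix.one_apply_ne hk)

/-- The tensor product `g₁ ⊗ ⋯ ⊗ gₙ` of elements of `SU(2)`. -/
def localUnitary (g : Fin n → Matrix.specialUnitaryGroup (Fin 2) ℂ) : Op n :=
  tensorOp fun k => (g k : Matrix (Fin 2) (Fin 2) ℂ)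

theorem conjTranspose_mul_localUnitary (g : Fin n → Matrix.specialUnitaryGroup (Fin 2) ℂ) :
    (localUnitary g)ᴴ * localUnitary g = 1 := by
  rw [localUnitary, conjTranspose_tensorOp, tensorOp_mul, ← tensorOp_one]
  congr 1
  funext k
  exact (Matrix.mem_unitaryGroup_iff').1 (Matrix.mem_specialUnitaryGroup_iff.1 (g k).2).1

theorem localUnitary_mul_conjTranspose (g : Fin n → Matrix.specialUnitaryGroup (Fin 2) ℂ) :
    localUnitary g * (localUnitary g)ᴴ = 1 :=
  mul_eq_one_comm.1 (conjTranspose_mul_localUnitary g)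

theorem IsState.conj {ρ : Op n} (hρ : IsState ρ)
    (g : Fin n → Matrix.specialUnitaryGroup (Fin 2) ℂ) :
    IsState (localUnitary g * ρ * (localUnitary g)ᴴ) := by
  refine ⟨hρ.1.mul_mul_conjTranspose_same _, ?_⟩
  rw [Matrix.trace_mul_comm, ← mul_assoc, conjTranspose_mul_localUnitary, one_mul, hρ.2]

theorem mem_stabilizer {ρ : Op n} {M : LG n} :
    M ∈ stabilizer ρ ↔ localOp M * ρ = ρ * localOp M := by
  change ⁅localOp M, ρ⁆ = 0 ↔ _
  rw [Ring.lie_def, sub_eq_zero]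

/-- Stated for an abstract invertible T because it is applied both to local unitaries and to qubit
permutations. -/
theorem mul_eq_mul_iff_conj {R : Type*} [Ring R] {T T' a b x : R} (h1 : T * T' = 1)
    (h2 : T' * T = 1) (h : a * T = T * b) :
    a * (T * x * T') = T * x * T' * a ↔ b * x = x * b := by
  have h' : T' * a = b * T' := by
    calc T' * a = T' * (a * T) * T' := by simp only [mul_assoc, h1, mul_one]
      _ = b * T' := by rw [h, ← mul_assoc, h2, one_mul]
  have e1 : a * (T * x * T') = T * (b * x) * T' := by
    rw [← mul_assoc, ← mul_assoc, h]; simp only [mul_assoc]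
  have e2 : T * x * T' * a = T * (x * b) * T' := by
    rw [mul_assoc, h']; simp only [mul_assoc]
  rw [e1, e2]
  refine ⟨fun e => ?_, fun e => by rw [e]⟩
  calc b * x = T' * (T * (b * x) * T') * T := by
        rw [mul_assoc T, ← mul_assoc T', h2, one_mul, mul_assoc, h2, mul_one]
    _ = x * b := by rw [e, mul_assoc T, ← mul_assoc T', h2, one_mul, mul_assoc, h2, mul_one]

theorem mem_stabilizer_conj (g : Fin n → Matrix.specialUnitaryGroup (Fin 2) ℂ) (ρ : Op n)
    {M N : LG n} (h : ∀ k, (M k).1 * (g k).1 = (g k).1 * (N k).1) :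
    M ∈ stabilizer (localUnitary g * ρ * (localUnitary g)ᴴ) ↔ N ∈ stabilizer ρ := by
  rw [mem_stabilizer, mem_stabilizer]
  exact mul_eq_mul_iff_conj (localUnitary_mul_conjTranspose g) (conjTranspose_mul_localUnitary g)
    (localOp_mul_tensorOp _ h)

end Conjugation

/-! ### Qubit permutations. -/

section Permutations

variable {n : ℕ}

theorem permOp_mul_tensorOp (π : Equiv.Perm (Fin n)) (X : Fin n → Matrix (Fin 2) (Fin 2) ℂ) :
    permOp π * tensorOp X = tensorOp (X ∘ ⇑π⁻¹) * permOp π := by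
  ext I J
  have h : ∀ L : Fin n → Fin 2, I = L ∘ ⇑π⁻¹ ↔ L = I ∘ π := fun L =>
    ⟨by rintro rfl; ext; simp, by rintro rfl; ext; simp⟩
  simp only [Matrix.mul_apply, permOp, tensorOp, Matrix.of_apply, h, ite_mul, one_mul, zero_mul,
    mul_ite, mul_one, mul_zero, Finset.sum_ite_eq', Finset.mem_univ, if_true]
  refine Fintype.prod_equiv π _ _ fun k => ?_
  simp

theorem permOp_mul_localOp (π : Equiv.Perm (Fin n)) (M : LG n) :
    permOp π * localOp M = localOp (M ∘ ⇑π⁻¹) * permOp π := by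
  simp only [localOp, Finset.sum_mul, Finset.mul_sum, siteOp, permOp_mul_tensorOp]
  refine Fintype.sum_equiv π _ _ fun k => ?_
  congr 2
  funext l
  by_cases hl : l = π k
  · subst hl; simp
  · have : π⁻¹ l ≠ k := fun e => hl (by rw [← e]; simp)
    rw [Function.comp_apply, Function.update_of_ne hl, Function.update_of_ne this]

theorem permOp_mul_permOp_inv (π : Equiv.Perm (Fin n)) : permOp π * permOp π⁻¹ = 1 := by
  ext I J
  simp [permOp, Matrix.mul_apply, Matrix.one_apply, Function.comp_assoc]

theorem isSymmetric_iff {ρ : Op n} :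
    IsSymmetric ρ ↔ ∀ π : Equiv.Perm (Fin n), permOp π * ρ = ρ * permOp π := by
  refine forall_congr' fun π => ?_
  have h1 := permOp_mul_permOp_inv π
  have h2 := mul_eq_one_comm.1 h1
  rw [permOp_inv]
  constructor
  · intro h
    nth_rw 2 [← h]
    rw [mul_assoc _ (permOp π⁻¹), h2, mul_one]
  · intro h
    rw [h, mul_assoc, h1, mul_one]

/-- Conjugation by P_π fixes ρ and carries the action of M ∘ π to that of M. -/
theorem IsSymmetric.comp_mem_stabilizer {ρ : Op n} (hρ : IsSymmetric ρ) {M : LG n}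
    (hM : M ∈ stabilizer ρ) (π : Equiv.Perm (Fin n)) : M ∘ π ∈ stabilizer ρ := by
  rw [isSymmetric_iff] at hρ
  rw [mem_stabilizer] at hM ⊢
  have h := permOp_mul_localOp π (M ∘ π)
  have hc : (M ∘ π) ∘ ⇑π⁻¹ = M := by ext; simp
  rw [hc] at h
  have h1 := permOp_mul_permOp_inv π
  have h2 := mul_eq_one_comm.1 h1
  have h3 : permOp π * ρ * permOp π⁻¹ = ρ := by rw [hρ, mul_assoc, h1, mul_one]
  rw [← mul_eq_mul_iff_conj h1 h2 h.symm, h3, hM]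

/-- With equal factors, g ⊗ ⋯ ⊗ g commutes with every P_π. -/
theorem IsSymmetric.conj {ρ : Op n} (hρ : IsSymmetric ρ)
    (g : Matrix.specialUnitaryGroup (Fin 2) ℂ) :
    IsSymmetric (localUnitary (fun _ => g) * ρ * (localUnitary (fun _ : Fin n => g))ᴴ) := by
  rw [isSymmetric_iff] at hρ ⊢
  intro π
  have h1 : permOp π * localUnitary (fun _ : Fin n => g) =
      localUnitary (fun _ => g) * permOp π := permOp_mul_tensorOp π _
  have h2 : permOp π * (localUnitary (fun _ : Fin n => g))ᴴ =
      (localUnitary (fun _ => g))ᴴ * permOp π := by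
    rw [localUnitary, conjTranspose_tensorOp]
    exact permOp_mul_tensorOp π _
  rw [← mul_assoc, ← mul_assoc, h1, mul_assoc _ (permOp π), hρ, mul_assoc, mul_assoc, h2]
  simp only [mul_assoc]

end Permutations

/-! ### Permutation-invariant subspaces and subalgebras. -/

section Invariant

variable {n : ℕ}

theorem exists_perm_apply_eq {α : Type*} [DecidableEq α] {i j k l : α} (hij : i ≠ j)
    (hkl : k ≠ l) : ∃ π : Equiv.Perm α, π i = k ∧ π j = l := by
  have h : Equiv.swap i k j ≠ k := fun h => hij.symm <| (Equiv.swap i k).injective (by simp [h])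
  refine ⟨Equiv.swap (Equiv.swap i k j) l * Equiv.swap i k, ?_, by simp⟩
  rw [Equiv.Perm.mul_apply, Equiv.swap_apply_left, Equiv.swap_apply_of_ne_of_ne h.symm hkl]

/-- The permutation invariant subspaces of `ℝⁿ`. -/
theorem invariant_submodule (V : Submodule ℝ (Fin n → ℝ))
    (hV : ∀ a ∈ V, ∀ π : Equiv.Perm (Fin n), a ∘ π ∈ V) :
    V = ⊤ ∨ (∀ a, a ∈ V ↔ ∑ k, a k = 0) ∨ (∀ a, a ∈ V ↔ ∃ t : ℝ, a = fun _ => t) ∨ V = ⊥ := by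
  by_cases h : ∃ a ∈ V, ∃ i j, a i ≠ a j
  · obtain ⟨a, ha, i, j, hij⟩ := h
    have hne : i ≠ j := fun e => hij (by rw [e])
    have hd : ∀ k l, (Pi.single k 1 - Pi.single l 1 : Fin n → ℝ) ∈ V := by
      intro k l
      by_cases hkl : k = l
      · rw [hkl, sub_self]; exact V.zero_mem
      obtain ⟨π, hk, hl⟩ := exists_perm_apply_eq hkl hne
      -- The vector a ∘ π takes the values a i at k and a j at l; subtracting its transposed copy
      -- cancels all other entries.
      have h1 : a ∘ π - (a ∘ π) ∘ Equiv.swap k l =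
          (a i - a j) • (Pi.single k 1 - Pi.single l 1 : Fin n → ℝ) := by
        funext m
        by_cases hmk : m = k
        · subst hmk; simp [hk, hl, hkl]
        by_cases hml : m = l
        · subst hml; simp [hk, hl, hmk]
        simp [Equiv.swap_apply_of_ne_of_ne hmk hml, hmk, hml]
      rw [← V.smul_mem_iff (sub_ne_zero.2 hij), ← h1]
      exact V.sub_mem (hV _ ha _) (hV _ (hV _ ha _) _)
    have hs : ∀ b : Fin n → ℝ, ∑ k, b k = 0 → b ∈ V := by
      intro b hb
      have : b = ∑ k, b k • (Pi.single k 1 - Pi.single i 1 : Fin n → ℝ) := by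
        simp only [smul_sub, Finset.sum_sub_distrib, ← Finset.sum_smul, hb, zero_smul, sub_zero]
        funext m
        simp [Finset.sum_apply, Pi.single_apply]
      rw [this]
      exact V.sum_mem fun k _ => V.smul_mem _ (hd k i)
    by_cases hb : ∃ b ∈ V, ∑ k, b k ≠ 0
    · obtain ⟨b, hb, hb0⟩ := hb
      refine Or.inl (eq_top_iff.2 fun c _ => ?_)
      -- The multiple of b is chosen so that the difference has coordinate sum zero.
      have h1 : c - ((∑ k, c k) / ∑ k, b k) • b ∈ V := by
        apply hs
        simp [Finset.sum_sub_distrib, ← Finset.mul_sum, hb0]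
      simpa using V.add_mem h1 (V.smul_mem ((∑ k, c k) / ∑ k, b k) hb)
    · push Not at hb
      exact Or.inr (Or.inl fun b => ⟨hb b, hs b⟩)
  · push Not at h
    by_cases hV0 : V = ⊥
    · exact Or.inr (Or.inr (Or.inr hV0))
    obtain ⟨b, hb, hb0⟩ := V.ne_bot_iff.1 hV0
    obtain ⟨i, hi⟩ := Function.ne_iff.1 hb0
    refine Or.inr (Or.inr (Or.inl fun a => ⟨fun ha => ⟨a i, funext fun k => h a ha k i⟩, ?_⟩))
    rintro ⟨t, rfl⟩
    have : (fun _ => t) = (t / b i) • b := by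
      funext k
      have hi' : b i ≠ 0 := hi
      simp [h b hb k i, hi']
    rw [this]
    exact V.smul_mem _ hb

variable (K : LieSubalgebra ℝ (LG n))

/-- Pulling K back along a ↦ ∑ aₖ A⁽ᵏ⁾ gives a permutation-invariant subspace of ℝⁿ, and K is
recovered as its image. -/
theorem classify_of_line (hK : ∀ M ∈ K, ∀ π : Equiv.Perm (Fin n), M ∘ π ∈ K)
    (hA : ∀ M ∈ K, ∀ k, ∃ c : ℝ, M k = c • A) :
    K = KProduct n ∨ K = KGHZ n ∨ K = KDicke n ∨ K = ⊥ := by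
  let φ : (Fin n → ℝ) →ₗ[ℝ] LG n :=
    { toFun := fun a k => a k • A
      map_add' := fun a b => funext fun k => add_smul _ _ _
      map_smul' := fun c a => funext fun k => mul_smul c (a k) A }
  have hφ : ∀ a, φ a = ∑ k, a k • atQubit k A := fun a => (sum_smul_atQubit a A).symm
  have hmem : ∀ M, M ∈ K ↔ ∃ a, φ a ∈ K ∧ M = φ a := by
    refine fun M => ⟨fun hM => ?_, ?_⟩
    · choose a ha using hA M hM
      have : M = φ a := funext ha
      exact ⟨a, this ▸ hM, this⟩
    · rintro ⟨a, ha, rfl⟩; exact ha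
  have hmem' : ∀ a, a ∈ K.toSubmodule.comap φ ↔ φ a ∈ K := fun a => Iff.rfl
  rcases invariant_submodule (K.toSubmodule.comap φ) (fun a ha π => hK _ ha π)
    with h | h | h | h
  · left
    ext M
    rw [hmem]
    refine exists_congr fun a => ?_
    rw [← hmem', h, hφ]
    simp
  · right; left
    ext M
    rw [hmem]
    refine exists_congr fun a => ?_
    rw [← hmem', h, hφ]
  · right; right; left
    ext M
    rw [hmem]
    have e : ∀ t : ℝ, (φ fun _ => t) = t • ∑ k, atQubit k A := fun t => by
      rw [hφ, Finset.smul_sum]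
    constructor
    · rintro ⟨a, ha, rfl⟩
      obtain ⟨t, rfl⟩ := (h a).1 ha
      exact ⟨t, e t⟩
    · rintro ⟨t, rfl⟩
      exact ⟨fun _ => t, (h _).2 ⟨t, rfl⟩, (e t).symm⟩
  · right; right; right
    ext M
    rw [hmem, LieSubalgebra.mem_bot]
    constructor
    · rintro ⟨a, ha, rfl⟩
      rw [← hmem', h, Submodule.mem_bot] at ha
      rw [ha, map_zero]
    · rintro rfl
      exact ⟨0, by rw [map_zero]; exact K.zero_mem, (map_zero φ).symm⟩

/-- The `k`-th components of the elements of `K` that vanish on `S`. -/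
def components (S : Finset (Fin n)) (k : Fin n) : Submodule ℝ su2 where
  carrier := {X | ∃ M ∈ K, M k = X ∧ ∀ j ∈ S, M j = 0}
  add_mem' := by
    rintro _ _ ⟨M, hM, rfl, hM'⟩ ⟨N, hN, rfl, hN'⟩
    exact ⟨M + N, K.add_mem hM hN, rfl, fun j hj => by simp [hM' j hj, hN' j hj]⟩
  zero_mem' := ⟨0, K.zero_mem, rfl, fun _ _ => rfl⟩
  smul_mem' := by
    rintro c _ ⟨M, hM, rfl, hM'⟩
    exact ⟨c • M, K.smul_mem c hM, rfl, fun j hj => by simp [hM' j hj]⟩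

theorem LG_lie_apply (M N : LG n) (k : Fin n) : ⁅M, N⁆ k = ⁅M k, N k⁆ := rfl

variable {K}

/-- `components K S k` is an ideal: every v is the k-th component of some N in K, and bracketing
with N preserves vanishing on S. Simplicity of su(2) finishes. -/
theorem components_eq_top (hp : ∀ k, components K ∅ k = ⊤) {S : Finset (Fin n)} {k : Fin n}
    {u : su2} (hu : u ∈ components K S k) (hu0 : u ≠ 0) : components K S k = ⊤ := by
  refine eq_top_of_lie_mem _ ?_ hu hu0
  rintro _ ⟨M, hM, rfl, hM'⟩ v
  obtain ⟨N, hN, rfl, -⟩ : v ∈ components K ∅ k := by rw [hp]; trivial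
  exact ⟨⁅M, N⁆, K.lie_mem hM hN, rfl, fun j hj => by rw [LG_lie_apply, hM' j hj, zero_lie]⟩

/-- The bracket of an element vanishing on S with one vanishing at j vanishes on both; noncommuting
k-th components keep it nonzero at k. -/
theorem components_eq_top_of_pairs (hp : ∀ k, components K ∅ k = ⊤)
    (h2 : ∀ j k, j ≠ k → components K {j} k = ⊤) {k : Fin n} (S : Finset (Fin n)) (hk : k ∉ S) :
    components K S k = ⊤ := by
  induction S using Finset.induction_on with
  | empty => exact hp k
  | insert j S _ ih =>
    rw [Finset.mem_insert, not_or] at hk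
    obtain ⟨v, hv⟩ := exists_lie_ne_zero A_ne_zero
    obtain ⟨M, hM, hMk, hM'⟩ : A ∈ components K S k := by rw [ih hk.2]; trivial
    obtain ⟨N, hN, hNk, hN'⟩ : v ∈ components K {j} k := by
      rw [h2 j k (Ne.symm hk.1)]; trivial
    refine components_eq_top hp (u := ⁅A, v⁆) ⟨⁅M, N⁆, K.lie_mem hM hN, ?_, ?_⟩ hv
    · rw [LG_lie_apply, hMk, hNk]
    · intro i hi
      rw [LG_lie_apply]
      rcases Finset.mem_insert.1 hi with rfl | hi
      · rw [hN' _ (Finset.mem_singleton_self _), lie_zero]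
      · rw [hM' i hi, zero_lie]

/-- Goursat's lemma for a permutation invariant subalgebra: it is everything, or each component
determines all the others. -/
theorem eq_top_or_components_injective (hK : ∀ M ∈ K, ∀ π : Equiv.Perm (Fin n), M ∘ π ∈ K)
    (hp : ∀ k, components K ∅ k = ⊤) :
    K = ⊤ ∨ ∀ M ∈ K, ∀ j, M j = 0 → M = 0 := by
  by_cases h : ∀ M ∈ K, ∀ j, M j = 0 → M = 0
  · exact Or.inr h
  left
  push Not at h
  obtain ⟨M, hM, j, hj, hM0⟩ := h
  obtain ⟨k, hk⟩ := Function.ne_iff.1 hM0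
  have hjk : j ≠ k := by rintro rfl; exact hk hj
  -- Permutations act transitively on ordered pairs of distinct indices, so the one element M serves
  -- every pair.
  have h2 : ∀ j k, j ≠ k → components K {j} k = ⊤ := by
    intro j' k' hjk'
    obtain ⟨π, h1, h2⟩ := exists_perm_apply_eq hjk' hjk
    exact components_eq_top hp ⟨M ∘ π, hK M hM π, congrArg M h2, by simp [h1, hj]⟩ hk
  rw [eq_top_iff]
  intro N _
  have hN : N = ∑ k, atQubit k (N k) := by
    funext l
    simp [atQubit, Finset.sum_apply, Pi.single_apply]
  rw [hN]
  refine K.toSubmodule.sum_mem fun k _ => ?_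
  obtain ⟨M, hM, hMk, hM'⟩ : N k ∈ components K (Finset.univ.erase k) k := by
    rw [components_eq_top_of_pairs hp h2 _ (Finset.notMem_erase k _)]; trivial
  have : atQubit k (N k) = M := by
    funext l
    by_cases hl : l = k
    · subst hl; simp [atQubit, hMk]
    · rw [hM' l (Finset.mem_erase.2 ⟨hl, Finset.mem_univ l⟩)]
      simp [atQubit, hl]
  rw [this]
  exact hM

theorem mem_KWerner {M : LG n} : M ∈ KWerner n ↔ ∃ X : su2, M = fun _ => X := by
  refine exists_congr fun X => ?_
  have h := sum_smul_atQubit (n := n) (fun _ => 1) X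
  simp only [one_smul] at h
  rw [h]

theorem eq_KWerner (hp : ∀ k, components K ∅ k = ⊤) (h : ∀ M ∈ K, ∀ i j, M i = M j) :
    K = KWerner n := by
  ext M
  rw [mem_KWerner]
  rcases isEmpty_or_nonempty (Fin n) with hn | ⟨⟨k⟩⟩
  · refine iff_of_true ?_ ⟨0, Subsingleton.elim _ _⟩
    rw [Subsingleton.elim M 0]
    exact K.zero_mem
  · refine ⟨fun hM => ⟨M k, funext fun i => h M hM i k⟩, ?_⟩
    rintro ⟨X, rfl⟩
    obtain ⟨N, hN, hNk, -⟩ : X ∈ components K ∅ k := by rw [hp]; trivial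
    have : (fun _ => X) = N := funext fun i => by rw [h N hN i k, hNk]
    rw [this]
    exact hN

/-- M minus its transposed copy vanishes at a third index, hence everywhere. For n ≤ 1 the indices i
and j coincide. -/
theorem apply_eq_apply_of_three_le (hn : n ≠ 2)
    (hK : ∀ M ∈ K, ∀ π : Equiv.Perm (Fin n), M ∘ π ∈ K)
    (hinj : ∀ M ∈ K, ∀ j, M j = 0 → M = 0) {M : LG n} (hM : M ∈ K) (i j : Fin n) :
    M i = M j := by
  by_cases hij : i = j
  · rw [hij]
  obtain ⟨k, hki, hkj⟩ : ∃ k, k ≠ i ∧ k ≠ j := by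
    by_contra! h
    have hsub : (Finset.univ : Finset (Fin n)) = {i, j} := by
      ext k
      simp only [Finset.mem_univ, Finset.mem_insert, Finset.mem_singleton, true_iff]
      by_cases hk : k = i
      · exact Or.inl hk
      · exact Or.inr (h k hk)
    have := congrArg Finset.card hsub
    rw [Finset.card_pair hij, Finset.card_univ, Fintype.card_fin] at this
    exact hn this
  have h := hinj _ (K.sub_mem hM (hK M hM (Equiv.swap i j))) k
    (by simp [Equiv.swap_apply_of_ne_of_ne hki hkj])
  have := congrFun h i
  simpa [sub_eq_zero] using this

/-- By symmetry all components of elements of K lie in the same projection. Off a line it contains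
two noncommuting vectors, which with their bracket span su(2). -/
theorem line_or_components_eq_top (hK : ∀ M ∈ K, ∀ π : Equiv.Perm (Fin n), M ∘ π ∈ K) :
    (∃ u : su2, u ≠ 0 ∧ ∀ M ∈ K, ∀ k, ∃ c : ℝ, M k = c • u) ∨ ∀ k, components K ∅ k = ⊤ := by
  rw [or_iff_not_imp_left]
  intro h k
  push Not at h
  have hmem : ∀ M ∈ K, ∀ i, M i ∈ components K ∅ k := fun M hM i =>
    ⟨M ∘ Equiv.swap i k, hK M hM _, by simp, by simp⟩
  -- A is an arbitrary choice here: it only yields some nonzero component M i, whose own line is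
  -- then escaped by N j.
  obtain ⟨M, hM, i, hi⟩ := h A A_ne_zero
  have hMi : M i ≠ 0 := by simpa using hi 0
  obtain ⟨N, hN, j, hj⟩ := h (M i) hMi
  have hne : ⁅M i, N j⁆ ≠ 0 := fun e => by
    obtain ⟨c, hc⟩ := eq_smul_of_lie_eq_zero hMi e
    exact hj c hc
  rw [eq_top_iff]
  intro w _
  refine mem_of_mem_of_lie_mem hne _ (hmem M hM i) (hmem N hN j) ?_ w
  obtain ⟨M', hM', h1, -⟩ := hmem M hM i
  obtain ⟨N', hN', h2, -⟩ := hmem N hN j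
  exact ⟨⁅M', N'⁆, K.lie_mem hM' hN', by rw [LG_lie_apply, h1, h2], by simp⟩

end Invariant

/-! ### The exceptional case of two qubits. -/

section TwoQubits

theorem coe_mul_self_unit {x : su2} (hx : dot x x = 1) : x.1 * x.1 = -1 := by
  rw [mul_self_su2, hx]; simp

theorem siteOp_neg_one {n : ℕ} (k : Fin n) : siteOp k (-1) = -1 := by
  rw [← tensorOp_one]
  ext I J
  simp [siteOp_apply, tensorOp, ← Finset.mul_prod_erase _ _ (Finset.mem_univ k)]

/-- This writes x ⊗ x as a polynomial in x ⊗ 1 + 1 ⊗ x, so whatever commutes with the latter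
commutes with the former. -/
theorem localOp_const_mul_self {x : su2} (hx : dot x x = 1) :
    localOp (fun _ : Fin 2 => x) * localOp (fun _ : Fin 2 => x) =
      2 * tensorOp (fun _ : Fin 2 => x.1) - 2 := by
  have h : siteOp (0 : Fin 2) x.1 * siteOp 1 x.1 = tensorOp (fun _ : Fin 2 => x.1) := by
    rw [siteOp, siteOp, tensorOp_mul]
    congr 1
    funext k
    fin_cases k <;> simp
  have h0 : siteOp (0 : Fin 2) x.1 * siteOp 0 x.1 = -1 := by
    rw [siteOp_mul_same, coe_mul_self_unit hx, siteOp_neg_one]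
  have h1 : siteOp (1 : Fin 2) x.1 * siteOp 1 x.1 = -1 := by
    rw [siteOp_mul_same, coe_mul_self_unit hx, siteOp_neg_one]
  have h2 : siteOp (1 : Fin 2) x.1 * siteOp 0 x.1 = tensorOp (fun _ : Fin 2 => x.1) := by
    rw [← siteOp_comm (by decide), h]
  simp only [localOp, Fin.sum_univ_two, add_mul, mul_add, h, h0, h1, h2]
  rw [show (2 : Op 2) = 1 + 1 by norm_num]
  noncomm_ring

theorem tensorOp_const_comm {x : su2} (hx : dot x x = 1) {ρ : Op 2}
    (h : (fun _ => x) ∈ stabilizer ρ) :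
    tensorOp (fun _ : Fin 2 => x.1) * ρ = ρ * tensorOp (fun _ : Fin 2 => x.1) := by
  rw [mem_stabilizer] at h
  have h2 : (2 * tensorOp (fun _ : Fin 2 => x.1) - 2) * ρ =
      ρ * (2 * tensorOp (fun _ : Fin 2 => x.1) - 2) := by
    rw [← localOp_const_mul_self hx, mul_assoc, h, ← mul_assoc, h, mul_assoc]
  rw [sub_mul, mul_sub, two_mul (tensorOp _), two_mul ρ, mul_two ρ, sub_left_inj, add_mul, mul_add,
    ← two_smul ℂ, ← two_smul ℂ (ρ * _)] at h2
  exact smul_right_injective _ (two_ne_zero (α := ℂ)) h2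

/-- The local unitary `1 ⊗ x` for a unit vector `x` of `su(2)`. -/
def secondUnitary (x : su2) (hx : dot x x = 1) : Fin 2 → Matrix.specialUnitaryGroup (Fin 2) ℂ :=
  ![1, toSU x hx]

/-- Although 1 ⊗ x is not swap-invariant, x² = -1 gives P(1 ⊗ x) = (x ⊗ 1)P = -(1 ⊗ x)(x ⊗ x)P, and
both x ⊗ x and P commute with ρ. -/
theorem isSymmetric_conj_second {x : su2} (hx : dot x x = 1) {ρ : Op 2} (hρ : IsSymmetric ρ)
    (h : (fun _ => x) ∈ stabilizer ρ) :
    IsSymmetric (localUnitary (secondUnitary x hx) * ρ *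
      (localUnitary (secondUnitary x hx))ᴴ) := by
  rw [isSymmetric_iff] at hρ ⊢
  intro π
  have hcase : π = 1 ∨ π = Equiv.swap 0 1 := by
    revert π; decide
  rcases hcase with rfl | rfl
  · have : permOp (1 : Equiv.Perm (Fin 2)) = 1 := by
      ext I J
      simp [permOp, Matrix.one_apply]
    rw [this, one_mul, mul_one]
  · set P := permOp (Equiv.swap (0 : Fin 2) 1)
    rw [mul_eq_mul_iff_conj (b := -(tensorOp (fun _ : Fin 2 => x.1) * P))
      (localUnitary_mul_conjTranspose _) (conjTranspose_mul_localUnitary _)]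
    · rw [neg_mul, mul_neg, mul_assoc, hρ, ← mul_assoc, tensorOp_const_comm hx h, mul_assoc]
    · rw [localUnitary, permOp_mul_tensorOp, mul_neg, ← mul_assoc, tensorOp_mul, ← neg_mul]
      congr 1
      ext I J
      have e : x.1 * x.1 = -1 := coe_mul_self_unit hx
      simp [tensorOp, Fin.prod_univ_two, secondUnitary, toSU, e]

/-- Conjugation by 1 ⊗ x applies the involution `rot x` to the second component, turning its graph
into the diagonal. -/
theorem eq_KWerner_second {x : su2} (hx : dot x x = 1) {ρ : Op 2}
    (hinj : ∀ M ∈ stabilizer ρ, ∀ j, M j = 0 → M = 0)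
    (h : ∀ X, ![X, rot x X] ∈ stabilizer ρ) :
    stabilizer (localUnitary (secondUnitary x hx) * ρ *
      (localUnitary (secondUnitary x hx))ᴴ) = KWerner 2 := by
  have hmem : ∀ M : LG 2, M ∈ stabilizer (localUnitary (secondUnitary x hx) * ρ *
      (localUnitary (secondUnitary x hx))ᴴ) ↔ ![M 0, rot x (M 1)] ∈ stabilizer ρ := by
    intro M
    apply mem_stabilizer_conj
    intro k
    fin_cases k
    · simp [secondUnitary]
    · exact mul_eq_mul_rot hx (M 1)
  ext M
  rw [hmem, mem_KWerner]
  constructor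
  · intro hM
    have h1 := hinj _ ((stabilizer ρ).sub_mem hM (h (M 0))) 0 (by simp)
    have h2 : rot x (M 1) = rot x (M 0) := by
      simpa [sub_eq_zero] using congrFun h1 1
    have h3 : M 1 = M 0 := by rw [← rot_rot hx (M 1), h2, rot_rot hx]
    exact ⟨M 0, funext fun k => by fin_cases k <;> simp [h3]⟩
  · rintro ⟨X, rfl⟩
    exact h X

/-- A permutation invariant graph of a nontrivial automorphism is the graph of a rotation
by `π`. -/
theorem exists_rot_mem (K : LieSubalgebra ℝ (LG 2))
    (hK : ∀ M ∈ K, ∀ π : Equiv.Perm (Fin 2), M ∘ π ∈ K)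
    (hp : ∀ k, components K ∅ k = ⊤) {u : su2} (hu : u ≠ 0) (hum : ![u, -u] ∈ K) :
    ∃ x, dot x x = 1 ∧ (fun _ => x) ∈ K ∧ ∀ X, ![X, rot x X] ∈ K := by
  have hlie : ∀ {a b c d : su2}, ![a, b] ∈ K → ![c, d] ∈ K → ![⁅a, c⁆, ⁅b, d⁆] ∈ K := by
    intro a b c d h1 h2
    have := K.lie_mem h1 h2
    convert this using 1
    funext k
    fin_cases k <;> rfl
  have hsmul : ∀ (s : ℝ) {a b : su2}, ![a, b] ∈ K → ![s • a, s • b] ∈ K := by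
    intro s a b h
    simpa using K.smul_mem s h
  have hadd : ∀ {a b c d : su2}, ![a, b] ∈ K → ![c, d] ∈ K → ![a + c, b + d] ∈ K := by
    intro a b c d h1 h2
    simpa using K.add_mem h1 h2
  have hswap : ∀ {a b : su2}, ![a, b] ∈ K → ![b, a] ∈ K := by
    intro a b h
    have := hK _ h (Equiv.swap 0 1)
    convert this using 1
    funext k
    fin_cases k <;> simp
  have hneg : ∀ {a b : su2}, ![a, b] ∈ K → ![-a, -b] ∈ K := fun h => by
    simpa using hsmul (-1) h
  obtain ⟨y, hyu, hl, hy⟩ : ∃ y : su2, dot y u = 0 ∧ ⁅u, y⁆ ≠ 0 ∧ ![y, y] ∈ K := by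
    obtain ⟨v, hv⟩ := exists_lie_ne_zero hu
    obtain ⟨M, hM, rfl, -⟩ : v ∈ components K ∅ 0 := by rw [hp]; trivial
    have hM2 : ![M 0, M 1] ∈ K := by
      convert hM using 1
      funext k
      fin_cases k <;> rfl
    have hplus : ![M 0 + M 1, M 0 + M 1] ∈ K := by
      have := hadd hM2 (hswap hM2)
      rwa [add_comm (M 1)] at this
    have hminus : ![M 0 - M 1, -(M 0 - M 1)] ∈ K := by
      have := hadd hM2 (hneg (hswap hM2))
      rwa [neg_sub, sub_eq_add_neg, sub_eq_add_neg]
    -- ⁅u, w⁆ is orthogonal to u, so it is a multiple of u only if it is zero.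
    have key : ∀ w : su2, ⁅u, w⁆ ≠ 0 → ⁅u, ⁅u, w⁆⁆ ≠ 0 := by
      intro w hw h0
      obtain ⟨c, hc⟩ := eq_smul_of_lie_eq_zero hu h0
      have h1 : dot u ⁅u, w⁆ = 0 := by simp [dot]; ring
      have h2 : dot u (c • u) = c * dot u u := by simp [dot]; ring
      rw [hc, h2] at h1
      rcases mul_eq_zero.1 h1 with h | h
      · rw [h, zero_smul] at hc
        exact hw hc
      · exact (dot_self_pos hu).ne' h
    -- Bracketing with (u, -u) exchanges the forms (a, a) and (a, -a). One bracket with the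
    -- difference gives y; if that vanishes, two brackets with the sum do.
    by_cases hm : ⁅u, M 0 - M 1⁆ = 0
    · have hp1 : ⁅u, M 0 + M 1⁆ ≠ 0 := by
        intro h0
        apply hv
        have : (2 : ℝ) • ⁅u, M 0⁆ = ⁅u, M 0 - M 1⁆ + ⁅u, M 0 + M 1⁆ := by
          rw [lie_sub, lie_add, two_smul]; abel
        rw [hm, h0, add_zero] at this
        exact (smul_eq_zero.1 this).resolve_left two_ne_zero
      refine ⟨⁅u, ⁅u, M 0 + M 1⁆⁆, by simp [dot]; ring, key _ (key _ hp1), ?_⟩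
      have := hlie hum (hlie hum hplus)
      rwa [neg_lie, neg_lie, lie_neg, neg_neg] at this
    · refine ⟨⁅u, M 0 - M 1⁆, by simp [dot]; ring, key _ hm, ?_⟩
      have := hlie hum hminus
      rwa [neg_lie, lie_neg, neg_neg] at this
  have hy0 : y ≠ 0 := by rintro rfl; exact hl (lie_zero u)
  obtain ⟨c, hc, hx⟩ := exists_smul_unit hy0
  have hxK := hsmul c hy
  have hxu : dot (c • y) u = 0 := by
    have : dot (c • y) u = c * dot y u := by simp [dot]; ring
    rw [this, hyu, mul_zero]
  refine ⟨c • y, hx, ?_, ?_⟩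
  · convert hxK using 1
    funext k
    fin_cases k <;> rfl
  have hlx : ⁅u, c • y⁆ ≠ 0 := by
    rw [lie_smul]
    exact smul_ne_zero hc hl
  let S : Submodule ℝ su2 :=
    { carrier := {X | ![X, rot (c • y) X] ∈ K}
      add_mem' := fun {a b} ha hb => by
        change ![a + b, rot (c • y) (a + b)] ∈ K
        rw [rot_add]
        exact hadd ha hb
      zero_mem' := by
        have h0 : rot (c • y) 0 = 0 := by simp [rot, dot]
        change ![0, rot (c • y) 0] ∈ K
        rw [h0]
        simpa using hsmul 0 hum
      smul_mem' := fun s a ha => by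
        change ![s • a, rot (c • y) (s • a)] ∈ K
        rw [rot_smul]
        exact hsmul s ha }
  have hperp : ∀ X, dot (c • y) X = 0 → ![X, -X] ∈ K → X ∈ S := by
    intro X h0 hX
    change ![X, rot (c • y) X] ∈ K
    rwa [rot, h0, mul_zero, zero_smul, zero_sub]
  -- With x = c • y, the rotation fixes x and negates u and ⁅u, x⁆, both orthogonal to x. K contains
  -- the three matching pairs, and these vectors span su(2).
  refine mem_of_mem_of_lie_mem hlx S (hperp u hxu hum) ?_ (hperp _ ?_ ?_)
  · change ![c • y, rot (c • y) (c • y)] ∈ K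
    rwa [rot, hx, mul_one, two_smul, add_sub_cancel_right]
  · simp [dot]; ring
  · have := hlie hum hxK
    rwa [neg_lie] at this

end TwoQubits

end SymStab

open SymStab in

theorem theorem2 (n : ℕ) (ρ : SymStab.Op n) (hρ : SymStab.IsState ρ)
    (hsym : SymStab.IsSymmetric ρ) :
    ∃ ρ' : SymStab.Op n, SymStab.IsState ρ' ∧ SymStab.IsSymmetric ρ' ∧
      SymStab.LUEquivalent ρ ρ' ∧
      (SymStab.stabilizer ρ' = ⊤ ∨
        SymStab.stabilizer ρ' = SymStab.KWerner n ∨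
        SymStab.stabilizer ρ' = SymStab.KProduct n ∨
        SymStab.stabilizer ρ' = SymStab.KGHZ n ∨
        SymStab.stabilizer ρ' = SymStab.KDicke n ∨
        SymStab.stabilizer ρ' = ⊥) := by
  have hK : ∀ M ∈ stabilizer ρ, ∀ π : Equiv.Perm (Fin n), M ∘ π ∈ stabilizer ρ :=
    fun M hM π => hsym.comp_mem_stabilizer hM π
  have hself : LUEquivalent ρ ρ := ⟨fun _ => 1, by simp [tensorOp_one]⟩
  rcases line_or_components_eq_top hK with ⟨u, hu, hline⟩ | hp
  · obtain ⟨x, hx, c, hc⟩ := exists_rot_eq hu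
    refine ⟨_, hρ.conj (fun _ => toSU x hx), hsym.conj _, ⟨_, rfl⟩, Or.inr (Or.inr ?_)⟩
    refine classify_of_line _ (fun M hM π => (hsym.conj _).comp_mem_stabilizer hM π) ?_
    intro M hM k
    rw [mem_stabilizer_conj (N := fun k => rot x (M k)) _ _ fun k => mul_eq_mul_rot hx (M k)] at hM
    obtain ⟨d, hd⟩ := hline _ hM k
    refine ⟨d * c, ?_⟩
    rw [← rot_rot hx (M k), hd, rot_smul, hc, smul_smul]
  rcases eq_top_or_components_injective hK hp with h | hinj
  · exact ⟨ρ, hρ, hsym, hself, Or.inl h⟩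
  by_cases hd : ∀ M ∈ stabilizer ρ, ∀ i j, M i = M j
  · exact ⟨ρ, hρ, hsym, hself, Or.inr (Or.inl (eq_KWerner hp hd))⟩
  obtain rfl : n = 2 := by
    by_contra hn
    exact hd fun M hM i j => apply_eq_apply_of_three_le hn hK hinj hM i j
  obtain ⟨u, hu, hum⟩ : ∃ u : su2, u ≠ 0 ∧ ![u, -u] ∈ stabilizer ρ := by
    push Not at hd
    obtain ⟨M, hM, i, j, hij⟩ := hd
    -- M minus its swapped copy has the form (u, -u).
    refine ⟨M 0 - M 1, fun h0 => hij ?_, ?_⟩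
    · fin_cases i <;> fin_cases j <;> simp_all [sub_eq_zero]
    · convert (stabilizer ρ).sub_mem hM (hK M hM (Equiv.swap 0 1)) using 1
      funext k
      fin_cases k <;> simp
  obtain ⟨x, hx, hxm, hrot⟩ := exists_rot_mem _ hK hp hu hum
  exact ⟨_, hρ.conj (secondUnitary x hx), isSymmetric_conj_second hx hsym hxm, ⟨_, rfl⟩,
    Or.inr (Or.inl (eq_KWerner_second hx hinj hrot))⟩
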